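/- For every $p\ge 1$ let $\Sigma_p$ be a $p\times p$ covariance matrix (symmetric, positive semidefinite) with positive diagonal entries $\sigma_{jj}$, let $D=D_p=\mathrm{diag}(\sigma_{11},\dots,\sigma_{pp})$, let $\rho=\rho_p=D^{-1/2}\Sigma_pD^{-1/2}$ be the correlation matrix, with eigenvalues $\lambda_1,\dots,\lambda_p$, and let $\mu=\mu_p$ and $\mu_1=\mu_{1,p}$ be vectors in $\mathbb{R}^p$. Put $\delta=\delta_p=\mu_1-\mu$. Assume that 1. for $i=1,\dots,6$ the limit $\lim_{p\to\infty}p^{-1}\,\mathrm{tr}(\rho^i)$ exists and $0<\lim_{p\to\infty}p^{-1}\,\mathrm{tr}(\rho^i)<\infty$; 2. $\lim_{p\to\infty}p^{-1/2}\max_{1\le j\le p}\lambda_j=0$; 3. for some $\varepsilon>0$, $\delta=O(p^{-1-\varepsilon/2})$ coordinatewise, that is, there is a constant $C$ with $\max_{1\le j\le p}|\delta_j|\le C\,p^{-1-\varepsilon/2}$ for all sufficiently large $p$. For a random vector $X$ in $\mathbb{R}^p$ let $$U=\frac{(X-\mu)'D^{-1}(X-\mu)-p}{\sqrt{2\,\mathrm{tr}(\rho^2)}}.$$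 Let $0<\alpha<1$, let $\Phi$ be the standard normal distribution function, and let $z_\alpha$ be the upper $100\alpha\%$ percentile of the standard normal distribution, $1-\Phi(z_\alpha)=\alpha$. Then the type II error probability $\Pr(U\le z_\alpha\mid\mu_1)$, that is, the probability of $U\le z_\alpha$ when $X\sim N_p(\mu_1,\Sigma_p)$, satisfies $$\lim_{p\to\infty}\left[\Pr\left(U\le z_\alpha\mid\mu_1\right)-\Phi\left(z_\alpha-\frac{\delta'D^{-1}\delta}{\sqrt{2\,\mathrm{tr}(\rho^2)}}\right)\right]=0.$$ -/

import Mathlib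

open MeasureTheory ProbabilityTheory Filter Topology Matrix

noncomputable section

namespace MeanChart

/-- The diagonal matrix `D` of the variances of a covariance matrix `S`. -/
def varianceMatrix {p : ℕ} (S : Matrix (Fin p) (Fin p) ℝ) : Matrix (Fin p) (Fin p) ℝ :=
  Matrix.diagonal fun j => S j j

/-- The matrix `D^{-1/2}`. -/
def invSqrtVarianceMatrix {p : ℕ} (S : Matrix (Fin p) (Fin p) ℝ) :
    Matrix (Fin p) (Fin p) ℝ :=
  Matrix.diagonal fun j => (√(S j j))⁻¹

/-- The correlation matrix `ρ = D^{-1/2} S D^{-1/2}`. -/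
def correlationMatrix {p : ℕ} (S : Matrix (Fin p) (Fin p) ℝ) : Matrix (Fin p) (Fin p) ℝ :=
  invSqrtVarianceMatrix S * S * invSqrtVarianceMatrix S

theorem correlationMatrix_isHermitian {p : ℕ} {S : Matrix (Fin p) (Fin p) ℝ}
    (hS : S.PosSemidef) : (correlationMatrix S).IsHermitian := by
  have h := Matrix.isHermitian_mul_mul_conjTranspose (invSqrtVarianceMatrix S) hS.isHermitian
  have h2 : (invSqrtVarianceMatrix S)ᴴ = invSqrtVarianceMatrix S := by
    simp [invSqrtVarianceMatrix]
  rwa [h2] at h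

/-- The largest eigenvalue of the correlation matrix of the covariance matrix `S`. -/
def maxEigenvalue {p : ℕ} {S : Matrix (Fin p) (Fin p) ℝ} (hS : S.PosSemidef) : ℝ :=
  ⨆ j, (correlationMatrix_isHermitian hS).eigenvalues j

/-- The quadratic form `v' D⁻¹ v`. -/
def invVarianceForm {p : ℕ} (S : Matrix (Fin p) (Fin p) ℝ) (v : EuclideanSpace ℝ (Fin p)) : ℝ :=
  v ⬝ᵥ ((varianceMatrix S)⁻¹ *ᵥ v)

/-- The modified squared Mahalanobis distance `M² = (x - μ)' D⁻¹ (x - μ)`. -/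
def modifiedMahalanobisSq {p : ℕ} (S : Matrix (Fin p) (Fin p) ℝ)
    (μ x : EuclideanSpace ℝ (Fin p)) : ℝ :=
  invVarianceForm S (x - μ)

/-- The statistic `U = (M² - p) / √(2 tr ρ²)`. -/
def chartStatistic {p : ℕ} (S : Matrix (Fin p) (Fin p) ℝ)
    (μ x : EuclideanSpace ℝ (Fin p)) : ℝ :=
  (modifiedMahalanobisSq S μ x - p) / √(2 * (correlationMatrix S ^ 2).trace)

/-- The standard normal distribution function `Φ`. -/
def stdNormalCDF (x : ℝ) : ℝ :=
  cdf (gaussianReal 0 1) x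

/-- The upper `100 α %` percentile `z_α` of the standard normal distribution, that is, the
solution of `1 - Φ(z) = α` (for `0 < α < 1`). -/
def upperPercentile (α : ℝ) : ℝ :=
  sInf {z : ℝ | 1 - stdNormalCDF z ≤ α}

/-- `0 < lim p⁻¹ tr(ρ^i) < ∞` for `i = 1, …, 6`. -/
def TraceAssumption (S : ∀ p : ℕ, Matrix (Fin p) (Fin p) ℝ) : Prop :=
  ∀ i ∈ Finset.Icc 1 6, ∃ L : ℝ, 0 < L ∧
    Tendsto (fun p : ℕ => (p : ℝ)⁻¹ * (correlationMatrix (S p) ^ i).trace) atTop (𝓝 L)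

/-- `lim (max_j λ_j) p^{-1/2} = 0`. -/
def EigenvalueAssumption (S : ∀ p : ℕ, Matrix (Fin p) (Fin p) ℝ)
    (hS : ∀ p, (S p).PosSemidef) : Prop :=
  Tendsto (fun p : ℕ => maxEigenvalue (hS p) * (p : ℝ) ^ (-(1 / 2 : ℝ))) atTop (𝓝 0)

/-- `δ = O(p^{-1-ε/2})`, read coordinatewise with one constant for all coordinates. -/
def ShiftOrder (δ : ∀ p : ℕ, EuclideanSpace ℝ (Fin p)) (ε : ℝ) : Prop :=
  ∃ C : ℝ, ∀ᶠ p : ℕ in atTop, ∀ j : Fin p, |δ p j| ≤ C * (p : ℝ) ^ (-1 - ε / 2)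

end MeanChart

end

/-! Diagonalize `ρ` with eigenvalues `λ_j`, and put `q = δ'D⁻¹δ`, `s = √(2 tr ρ²)`, `m = q / s`.
Under `μ₁` the statistic has the law of `∑ a_j (x_j² - 1)/√2 + (2/s) ∑ c_j x_j + m`, with `x_j`
independent standard normal, `a_j = √2 λ_j / s` and `∑ c_j² ≤ λ_max q`
(`exists_chartStatistic_law`).

The weights satisfy `∑ a_j² = 1` and `max a_j = √2 λ_max / s → 0`, so the first sum is
asymptotically standard normal (`tendsto_weighted_sum_real_le`). The linear term has variance at
most `4 (λ_max / s) m`. By Chebyshev it is smaller than `k (1 + m)`, with `k → 0`, outside an event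
of vanishing probability. Hence the probability lies, up to `o(1)`, between values of the first
sum's distribution function at `z - m ± k (1 + m)`. These differ from `Φ(z - m)` by `o(1)` whatever
the size of `m` (`tendsto_shifted_sub`): a bounded `m` makes the perturbation negligible, and for `m
→ ∞` both terms vanish. -/

namespace MeanChart

/-! ### Central limit theorem for normalized, uniformly negligible weights -/

/-- Products of complex numbers in the unit disc are 1-Lipschitz in each factor. -/
theorem norm_prod_sub_prod_le {ι : Type*} (s : Finset ι) (f g : ι → ℂ)
    (hf : ∀ i, ‖f i‖ ≤ 1) (hg : ∀ i, ‖g i‖ ≤ 1) :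
    ‖∏ i ∈ s, f i - ∏ i ∈ s, g i‖ ≤ ∑ i ∈ s, ‖f i - g i‖ := by
  classical
  induction s using Finset.induction_on with
  | empty => simp
  | insert i s hi ih =>
    rw [Finset.prod_insert hi, Finset.prod_insert hi, Finset.sum_insert hi]
    have hp : ‖∏ i ∈ s, f i‖ ≤ 1 := by
      rw [norm_prod]
      exact Finset.prod_le_one (fun _ _ => norm_nonneg _) fun j _ => hf j
    calc ‖f i * ∏ i ∈ s, f i - g i * ∏ i ∈ s, g i‖
        = ‖(f i - g i) * ∏ i ∈ s, f i + g i * (∏ i ∈ s, f i - ∏ i ∈ s, g i)‖ := by ring_nf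
      _ ≤ ‖f i - g i‖ * ‖∏ i ∈ s, f i‖ + ‖g i‖ * ‖∏ i ∈ s, f i - ∏ i ∈ s, g i‖ := by
          rw [← norm_mul, ← norm_mul]
          exact norm_add_le _ _
      _ ≤ ‖f i - g i‖ * 1 + 1 * ∑ i ∈ s, ‖f i - g i‖ := by
          gcongr
          exact hg i
      _ = _ := by ring

/-- The characteristic function of a centred law with unit variance agrees with the Gaussian one
up to `o(t²)` at the origin. -/
theorem charFun_sub_exp_isLittleO (ν : Measure ℝ) [IsProbabilityMeasure ν]
    (h0 : ∫ x, x ∂ν = 0) (h1 : ∫ x, x ^ 2 ∂ν = 1) :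
    (fun t : ℝ => charFun ν t - Complex.exp (-(t : ℂ) ^ 2 / 2)) =o[𝓝 0] fun t => t ^ 2 := by
  -- Both characteristic functions are `1 - t²/2 + o(t²)`.
  have hν := taylor_charFun_two (P := ν) (X := id) aemeasurable_id (by simpa using h0)
    (by simpa using h1)
  have hg := taylor_charFun_two (P := gaussianReal 0 1) (X := id) aemeasurable_id
    (by simp [integral_id_gaussianReal]) (by
      have := variance_id_gaussianReal (μ := 0) (v := 1)
      rw [variance_eq_integral aemeasurable_id] at this
      simpa [integral_id_gaussianReal] using this)
  simp only [Measure.map_id, charFun_gaussianReal] at hν hg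
  refine (hν.sub hg).congr_left fun t => ?_
  simp [neg_div]

/-- Because `∑ a_j² = 1`, the Gaussian limit splits into factors `exp(-(a_j t)²/2)`, and the
products are compared factor by factor. Negligibility puts all `a_j t` in one small neighbourhood of
`0`, where each error is at most a small multiple of `(a_j t)²`; these bounds sum to that multiple
of `t²`. -/
theorem tendsto_prod_charFun_of_negligible (ν : Measure ℝ) [IsProbabilityMeasure ν]
    (h0 : ∫ x, x ∂ν = 0) (h1 : ∫ x, x ^ 2 ∂ν = 1) (a : ∀ p : ℕ, Fin p → ℝ)
    (hsq : ∀ᶠ p in atTop, ∑ j, a p j ^ 2 = 1) (e : ℕ → ℝ) (he : Tendsto e atTop (𝓝 0))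
    (hbd : ∀ᶠ p in atTop, ∀ j, |a p j| ≤ e p) (t : ℝ) :
    Tendsto (fun p => ∏ j, charFun ν (a p j * t)) atTop (𝓝 (Complex.exp (-(t : ℂ) ^ 2 / 2))) := by
  rw [Metric.tendsto_nhds]
  intro ε hε
  -- The total error will be `ε t² / (t² + 1)`, strictly below `ε` even at `t = 0`.
  have hc : 0 < ε / (t ^ 2 + 1) := by positivity
  obtain ⟨r, hr, hball⟩ := Metric.eventually_nhds_iff.1
    ((charFun_sub_exp_isLittleO ν h0 h1).def hc)
  have het : Tendsto (fun p => e p * |t|) atTop (𝓝 0) := by simpa using he.mul_const |t|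
  filter_upwards [hsq, hbd, het.eventually_lt_const hr] with p hp1 hp2 hp3
  have hexp : Complex.exp (-(t : ℂ) ^ 2 / 2)
      = ∏ j, Complex.exp (-((a p j * t : ℝ) : ℂ) ^ 2 / 2) := by
    rw [← Complex.exp_sum]
    congr 1
    rw [← Finset.sum_div, Finset.sum_neg_distrib]
    congr 2
    have : ∑ j, (a p j * t) ^ 2 = t ^ 2 := by simp [mul_pow, ← Finset.sum_mul, hp1]
    exact_mod_cast this.symm
  rw [dist_eq_norm, hexp]
  calc _ ≤ ∑ j, ‖charFun ν (a p j * t) - Complex.exp (-((a p j * t : ℝ) : ℂ) ^ 2 / 2)‖ := by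
        refine norm_prod_sub_prod_le _ _ _ (fun j => norm_charFun_le_one _) fun j => ?_
        rw [Complex.norm_exp, ← Complex.ofReal_pow, ← Complex.ofReal_neg, Real.exp_le_one_iff]
        norm_cast
        nlinarith [sq_nonneg (a p j * t)]
    _ ≤ ∑ j, ε / (t ^ 2 + 1) * (a p j * t) ^ 2 := by
        refine Finset.sum_le_sum fun j _ => ?_
        have := hball (y := a p j * t) (by
          rw [Real.dist_0_eq_abs, abs_mul]
          exact (mul_le_mul_of_nonneg_right (hp2 j) (abs_nonneg t)).trans_lt hp3)
        rwa [Real.norm_of_nonneg (sq_nonneg _)] at this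
    _ = ε * (t ^ 2 / (t ^ 2 + 1)) := by
        simp_rw [mul_pow]
        rw [← Finset.mul_sum, ← Finset.sum_mul, hp1]
        ring
    _ < ε * 1 := by
        gcongr
        rw [div_lt_one (by positivity)]
        linarith
    _ = ε := mul_one ε

theorem charFun_map_weighted_sum_pi {ι : Type*} [Fintype ι] (ν : Measure ℝ)
    [IsProbabilityMeasure ν] (f : ℝ → ℝ) (hf : Measurable f) (a : ι → ℝ) (t : ℝ) :
    charFun ((Measure.pi fun _ : ι => ν).map fun x => ∑ j, a j * f (x j)) t
      = ∏ j, charFun (ν.map f) (a j * t) := by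
  have hchar (u : ℝ) : charFun (ν.map f) u = ∫ x, Complex.exp (u * f x * Complex.I) ∂ν := by
    rw [charFun_apply_real, integral_map hf.aemeasurable (by fun_prop)]
  have hm : Measurable fun x : ι → ℝ => ∑ j, a j * f (x j) := by fun_prop
  simp_rw [hchar]
  rw [charFun_apply_real, integral_map hm.aemeasurable (by fun_prop)]
  rw [← integral_fintype_prod_eq_prod (𝕜 := ℂ)
    (f := fun j x => Complex.exp ((a j * t : ℝ) * (f x : ℝ) * Complex.I))]
  congr 1 with x
  rw [← Complex.exp_sum]
  congr 1
  push_cast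
  rw [Finset.mul_sum, Finset.sum_mul]
  exact Finset.sum_congr rfl fun j _ => by ring

/-- The distribution functions of weighted sums of independent standardized variables converge to
the normal one when the weights are normalized and uniformly negligible. -/
theorem tendsto_weighted_sum_real_le (ν : Measure ℝ) [IsProbabilityMeasure ν]
    (f : ℝ → ℝ) (hf : Measurable f)
    (h0 : ∫ x, f x ∂ν = 0) (h1 : ∫ x, f x ^ 2 ∂ν = 1) (a : ∀ p : ℕ, Fin p → ℝ)
    (hsq : ∀ᶠ p in atTop, ∑ j, a p j ^ 2 = 1) (e : ℕ → ℝ) (he : Tendsto e atTop (𝓝 0))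
    (hbd : ∀ᶠ p in atTop, ∀ j, |a p j| ≤ e p) (z : ℝ) :
    Tendsto (fun p => (Measure.pi fun _ : Fin p => ν).real {x | ∑ j, a p j * f (x j) ≤ z})
      atTop (𝓝 (cdf (gaussianReal 0 1) z)) := by
  have hm (p : ℕ) : Measurable fun x : Fin p → ℝ => ∑ j, a p j * f (x j) := by fun_prop
  have hνf : IsProbabilityMeasure (ν.map f) := Measure.isProbabilityMeasure_map hf.aemeasurable
  let M (p : ℕ) : ProbabilityMeasure ℝ :=
    ⟨(Measure.pi fun _ : Fin p => ν).map fun x => ∑ j, a p j * f (x j),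
      Measure.isProbabilityMeasure_map (hm p).aemeasurable⟩
  let M₀ : ProbabilityMeasure ℝ := ⟨gaussianReal 0 1, inferInstance⟩
  have hM : Tendsto M atTop (𝓝 M₀) := by
    refine ProbabilityMeasure.tendsto_of_tendsto_charFun fun t => ?_
    have := tendsto_prod_charFun_of_negligible (ν.map f)
      (by rwa [integral_map hf.aemeasurable (by fun_prop)])
      (by rwa [integral_map hf.aemeasurable (by fun_prop)]) a hsq e he hbd t
    simpa [M, M₀, charFun_map_weighted_sum_pi ν f hf, charFun_gaussianReal, neg_div] using this
  -- Portmanteau: the frontier `{z}` of the half-line is null for the Gaussian limit.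
  have hz := ProbabilityMeasure.tendsto_measure_of_null_frontier_of_tendsto' hM
    (E := Set.Iic z) (by
      simp [M₀, gaussianReal_absolutelyContinuous 0 one_ne_zero (Real.volume_singleton)])
  have hz' := (ENNReal.tendsto_toReal (measure_ne_top _ _)).comp hz
  rw [cdf_eq_real]
  refine hz'.congr fun p => ?_
  simp only [Function.comp, M, ProbabilityMeasure.coe_mk, Measure.real]
  rw [Measure.map_apply (hm p) measurableSet_Iic]
  rfl

/-! ### Gaussian moments and a Chebyshev bound -/

theorem integrable_pow_gaussianReal (n : ℕ) :
    Integrable (fun x : ℝ => x ^ n) (gaussianReal 0 1) := by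
  simpa using (memLp_id_gaussianReal' (μ := 0) (v := 1) n (by simp)).integrable_norm_pow'.mono'
    (f := fun x : ℝ => x ^ n) (by fun_prop) (by simp)

theorem integral_sq_gaussianReal : ∫ x : ℝ, x ^ 2 ∂gaussianReal 0 1 = 1 := by
  have := variance_id_gaussianReal (μ := 0) (v := 1)
  rw [variance_eq_integral aemeasurable_id] at this
  simpa [integral_id_gaussianReal] using this

/-- With `φ` the normal density, `(x³ φ)' = (3x² - x⁴) φ` integrates to zero, so the fourth moment
is three times the second. -/
theorem integral_pow_four_gaussianReal : ∫ x : ℝ, x ^ 4 ∂gaussianReal 0 1 = 3 := by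
  have hd (x : ℝ) : HasDerivAt (fun x => x ^ 3 * gaussianPDFReal 0 1 x)
      (gaussianPDFReal 0 1 x * (3 * x ^ 2 - x ^ 4)) x := by
    have h1 : HasDerivAt (fun x : ℝ => -(x - 0) ^ 2 / (2 * ((1 : NNReal) : ℝ))) (-x) x := by
      convert! (((hasDerivAt_id x).sub_const 0).pow 2).neg.div_const (2 * ((1 : NNReal) : ℝ)) using 1
      push_cast
      simp only [id]
      ring
    have h2 := ((hasDerivAt_id x).pow 3).mul
      (h1.exp.const_mul (√(2 * Real.pi * ((1 : NNReal) : ℝ)))⁻¹)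
    convert! h2 using 1
    simp only [gaussianPDFReal, id, Pi.pow_apply]
    push_cast
    ring
  have hi (g : ℝ → ℝ) (hg : Integrable g (gaussianReal 0 1)) :
      Integrable fun x => gaussianPDFReal 0 1 x * g x := by
    rw [gaussianReal_of_var_ne_zero _ one_ne_zero,
      integrable_withDensity_iff_integrable_smul' (by fun_prop) (by simp [gaussianPDF])] at hg
    simpa [toReal_gaussianPDF] using hg
  have h4 := integrable_pow_gaussianReal 4
  have h2 := integrable_pow_gaussianReal 2
  have key := integral_eq_zero_of_hasDerivAt_of_integrable hd
    (hi _ ((h2.const_mul 3).sub h4))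
    ((hi _ (integrable_pow_gaussianReal 3)).congr (ae_of_all _ fun x => mul_comm _ _))
  have key2 : ∫ x : ℝ, (3 * x ^ 2 - x ^ 4) ∂gaussianReal 0 1 = 0 := by
    rw [integral_gaussianReal_eq_integral_smul one_ne_zero]
    simpa using key
  rw [integral_sub (h2.const_mul 3) h4, integral_const_mul, integral_sq_gaussianReal] at key2
  linarith

theorem integral_sq_sub_one_gaussianReal :
    ∫ x : ℝ, (x ^ 2 - 1) / √2 ∂gaussianReal 0 1 = 0 := by
  rw [integral_div, integral_sub (integrable_pow_gaussianReal 2) (integrable_const _),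
    integral_sq_gaussianReal]
  simp

theorem integral_sq_sub_one_sq_gaussianReal :
    ∫ x : ℝ, ((x ^ 2 - 1) / √2) ^ 2 ∂gaussianReal 0 1 = 1 := by
  have h4 := integrable_pow_gaussianReal 4
  have h2 := integrable_pow_gaussianReal 2
  have h (x : ℝ) : ((x ^ 2 - 1) / √2) ^ 2 = (x ^ 4 - 2 * x ^ 2 + 1) / 2 := by
    rw [div_pow, Real.sq_sqrt (by norm_num)]
    ring
  simp_rw [h]
  have hs : Integrable (fun x : ℝ => x ^ 4 - 2 * x ^ 2) (gaussianReal 0 1) :=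
    h4.sub (h2.const_mul 2)
  rw [integral_div, integral_add hs (integrable_const _), integral_sub h4 (h2.const_mul 2),
    integral_const_mul, integral_sq_gaussianReal,
    integral_pow_four_gaussianReal]
  norm_num

/-- Chebyshev's inequality for a linear form in independent standard normal variables. -/
theorem real_le_abs_linear_form_le {ι : Type*} [Fintype ι] (c : ι → ℝ) {r : ℝ} (hr : 0 < r) :
    (Measure.pi fun _ : ι => gaussianReal 0 1).real {x | r ≤ |∑ j, c j * x j|}
      ≤ (∑ j, c j ^ 2) / r ^ 2 := by
  have hL (j : ι) : MemLp (fun y : ℝ => c j * y) 2 (gaussianReal 0 1) :=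
    (memLp_id_gaussianReal' (μ := 0) (v := 1) 2 (by simp)).const_mul (c j)
  have hLp (j : ι) : MemLp (fun x : ι → ℝ => c j * x j) 2
      (Measure.pi fun _ : ι => gaussianReal 0 1) :=
    (hL j).comp_measurePreserving (measurePreserving_eval (fun _ : ι => gaussianReal 0 1) j)
  have hT : MemLp (fun x : ι → ℝ => ∑ j, c j * x j) 2
      (Measure.pi fun _ : ι => gaussianReal 0 1) := memLp_finsetSum _ fun j _ => hLp j
  have hE : ∫ x : ι → ℝ, ∑ j, c j * x j ∂(Measure.pi fun _ : ι => gaussianReal 0 1) = 0 := by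
    rw [integral_finsetSum _ fun j _ => (hLp j).integrable one_le_two]
    refine Finset.sum_eq_zero fun j _ => ?_
    have := (measurePreserving_eval (fun _ : ι => gaussianReal 0 1) j).hasLaw.integral_comp
      (f := fun y : ℝ => c j * y) (by fun_prop)
    exact this.trans (by rw [integral_const_mul, integral_id_gaussianReal, mul_zero])
  have hV : Var[fun x : ι → ℝ => ∑ j, c j * x j; Measure.pi fun _ : ι => gaussianReal 0 1]
      = ∑ j, c j ^ 2 := by
    have := variance_sum_pi (μ := fun _ : ι => gaussianReal 0 1) hL
    rw [show (fun x : ι → ℝ => ∑ j, c j * x j) = ∑ j, fun x : ι → ℝ => c j * x j by ext; simp,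
      this]
    refine Finset.sum_congr rfl fun j _ => ?_
    rw [variance_const_mul]
    have := variance_id_gaussianReal (μ := 0) (v := 1)
    simp only [NNReal.coe_one] at this
    erw [this, mul_one]
  have h := meas_ge_le_variance_div_sq hT hr
  rw [hE, hV] at h
  simp only [sub_zero] at h
  exact ENNReal.toReal_le_of_le_ofReal (by positivity) h

/-! ### Distribution functions along moving arguments -/

/-- Distribution functions converging pointwise to a continuous distribution function converge
along moving arguments. -/
theorem tendsto_apply_of_monotone {ι : Type*} {l : Filter ι} {F : ι → ℝ → ℝ} {G : ℝ → ℝ}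
    (hF : ∀ i, Monotone (F i)) (hG : Continuous G) (hFG : ∀ x, Tendsto (fun i => F i x) l (𝓝 (G x)))
    {u : ι → ℝ} {x : ℝ} (hu : Tendsto u l (𝓝 x)) : Tendsto (fun i => F i (u i)) l (𝓝 (G x)) := by
  refine tendsto_order.2 ⟨fun a ha => ?_, fun a ha => ?_⟩
  -- A fixed point `y < x` with `G y` still above `a`; eventually `y < u i`, so monotonicity reduces
  -- to convergence at `y`.
  · obtain ⟨y, hy1, hy2⟩ := ((hG.continuousAt.eventually_const_lt ha).filter_mono
      (nhdsWithin_le_nhds (s := Set.Iio x))).and self_mem_nhdsWithin |>.exists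
    filter_upwards [(hFG y).eventually_const_lt hy1, hu.eventually_const_lt hy2] with i h1 h2
    exact h1.trans_le (hF i h2.le)
  · obtain ⟨y, hy1, hy2⟩ := ((hG.continuousAt.eventually_lt_const ha).filter_mono
      (nhdsWithin_le_nhds (s := Set.Ioi x))).and self_mem_nhdsWithin |>.exists
    filter_upwards [(hFG y).eventually_lt_const hy1, hu.eventually_lt_const hy2] with i h1 h2
    exact (hF i h2.le).trans_lt h1

theorem tendsto_apply_of_monotone_atBot {ι : Type*} {l : Filter ι} {F : ι → ℝ → ℝ} {G : ℝ → ℝ}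
    (hF : ∀ i, Monotone (F i)) (hF0 : ∀ i x, 0 ≤ F i x) (hG : Tendsto G atBot (𝓝 0))
    (hFG : ∀ x, Tendsto (fun i => F i x) l (𝓝 (G x)))
    {u : ι → ℝ} (hu : Tendsto u l atBot) : Tendsto (fun i => F i (u i)) l (𝓝 0) := by
  refine tendsto_order.2 ⟨fun a ha => .of_forall fun i => ha.trans_le (hF0 i _), fun a ha => ?_⟩
  obtain ⟨y, hy⟩ := (hG.eventually_lt_const ha).exists
  filter_upwards [(hFG y).eventually_lt_const hy, hu.eventually_le_atBot y] with i h1 h2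
  exact (hF i h2).trans_lt h1

/-- A net of nonnegative reals either has a finite limit or tends to infinity along an
ultrafilter. -/
theorem ultrafilter_tendsto_nhds_or_atTop {ι : Type*} (g : Ultrafilter ι) {m : ι → ℝ}
    (hm : ∀ i, 0 ≤ m i) : (∃ x, Tendsto m g (𝓝 x)) ∨ Tendsto m g atTop := by
  by_cases h : ∃ K, ∀ᶠ i in g, m i ≤ K
  · obtain ⟨K, hK⟩ := h
    obtain ⟨x, -, hx⟩ := (isCompact_Icc (a := (0 : ℝ)) (b := K)).ultrafilter_le_nhds (g.map m)
      (by
        rw [le_principal_iff]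
        exact hK.mono fun i hi => ⟨hm i, hi⟩)
    exact .inl ⟨x, hx⟩
  · push Not at h
    refine .inr (tendsto_atTop.2 fun K => ?_)
    exact (h K).mono fun i hi => hi.le

/-- No bound on `m` is available, so `m` need not converge. Along an ultrafilter it either converges
or tends to infinity, and the difference tends to zero in each case. -/
theorem tendsto_shifted_sub {F : ℕ → ℝ → ℝ} {G : ℝ → ℝ}
    (hF : ∀ i, Monotone (F i)) (hF0 : ∀ i x, 0 ≤ F i x) (hG : Continuous G)
    (hG0 : Tendsto G atBot (𝓝 0))
    (hFG : ∀ x, Tendsto (fun i => F i x) atTop (𝓝 (G x))) {m k : ℕ → ℝ} (hm : ∀ i, 0 ≤ m i)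
    (hk : Tendsto k atTop (𝓝 0)) (z : ℝ) :
    Tendsto (fun i => F i (z - m i + k i * (1 + m i)) - G (z - m i)) atTop (𝓝 0) := by
  rw [tendsto_iff_ultrafilter]
  intro g hg
  have hFG' x := (hFG x).mono_left hg
  have hk' := hk.mono_left hg
  obtain ⟨x, hx⟩ | ht := ultrafilter_tendsto_nhds_or_atTop g hm
  · have hzx : Tendsto (fun i => z - m i) g (𝓝 (z - x)) := hx.const_sub z
    have hu : Tendsto (fun i => z - m i + k i * (1 + m i)) g (𝓝 (z - x)) := by
      simpa using hzx.add (hk'.mul (hx.const_add 1))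
    simpa using (tendsto_apply_of_monotone hF hG hFG' hu).sub ((hG.tendsto _).comp hzx)
  · have hzx : Tendsto (fun i => z - m i) g atBot := tendsto_atBot_add_const_left _ z
      (tendsto_neg_atTop_atBot.comp ht)
    have hu : Tendsto (fun i => z - m i + k i * (1 + m i)) g atBot := by
      -- Once `k i ≤ 1/2`, the argument is at most `(z + 1/2) - m i / 2`.
      have hb : Tendsto (fun i => (z + 1 / 2) - m i * (1 / 2)) g atBot :=
        tendsto_atBot_add_const_left _ _
          (tendsto_neg_atTop_atBot.comp (ht.atTop_mul_const (by norm_num)))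
      refine tendsto_atBot_mono' _ ?_ hb
      filter_upwards [hk'.eventually_le_const (show (0 : ℝ) < 1 / 2 by norm_num)] with i hi
      nlinarith [hm i]
    simpa using (tendsto_apply_of_monotone_atBot hF hF0 hG0 hFG' hu).sub (hG0.comp hzx)

/-- The Gaussian law has no atoms, so the distribution function has no jumps. -/
theorem continuous_cdf_gaussianReal : Continuous (cdf (gaussianReal 0 1)) := by
  rw [continuous_iff_continuousAt]
  intro x
  have h : (cdf (gaussianReal 0 1)).measure {x} = 0 := by
    rw [measure_cdf]
    exact gaussianReal_absolutelyContinuous 0 one_ne_zero Real.volume_singleton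
  rw [StieltjesFunction.measure_singleton, ENNReal.ofReal_eq_zero, sub_nonpos] at h
  rw [(monotone_cdf _).continuousAt_iff_leftLim_eq_rightLim, StieltjesFunction.rightLim_eq]
  exact le_antisymm ((monotone_cdf _).leftLim_le le_rfl) h

/-! ### Normal approximation of the noncentral quadratic form -/

/-- Normal approximation of weighted sums of noncentral chi-square variables, uniformly over the
noncentrality `q`. -/
theorem tendsto_noncentral_quadratic_form_sub_cdf
    (w : ∀ p : ℕ, Fin p → ℝ) (hw0 : ∀ p j, 0 ≤ w p j) (hw1 : ∀ p, ∑ j, w p j = p)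
    (s : ℕ → ℝ) (hs0 : ∀ p, 0 ≤ s p) (hspos : ∀ᶠ p in atTop, 0 < s p)
    (hs2 : ∀ p, s p ^ 2 = 2 * ∑ j, w p j ^ 2)
    (L : ℕ → ℝ) (hL : ∀ p j, w p j ≤ L p) (hLs : Tendsto (fun p => L p / s p) atTop (𝓝 0))
    (q : ℕ → ℝ) (hq : ∀ p, 0 ≤ q p) (c : ∀ p : ℕ, Fin p → ℝ)
    (hc : ∀ p, ∑ j, c p j ^ 2 ≤ L p * q p) (z : ℝ) :
    Tendsto (fun p => (Measure.pi fun _ : Fin p => gaussianReal 0 1).real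
        {x | (∑ j, w p j * x j ^ 2 + 2 * ∑ j, c p j * x j + q p - p) / s p ≤ z}
        - cdf (gaussianReal 0 1) (z - q p / s p)) atTop (𝓝 0) := by
  set f : ℝ → ℝ := fun x => (x ^ 2 - 1) / √2 with hf
  set a : ∀ p : ℕ, Fin p → ℝ := fun p j => √2 * w p j / s p with ha
  set F : ℕ → ℝ → ℝ := fun p z =>
    (Measure.pi fun _ : Fin p => gaussianReal 0 1).real {x | ∑ j, a p j * f (x j) ≤ z} with hF
  set m : ℕ → ℝ := fun p => q p / s p with hm
  -- `e p * m p` bounds the variance of the linear term; the summand `1 / (p + 1)` only keeps `e p`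
  -- positive, so that the Chebyshev radius is positive.
  set e : ℕ → ℝ := fun p => 4 * |L p / s p| + 1 / ((p : ℝ) + 1) with he
  have h2 : √2 ^ 2 = (2 : ℝ) := Real.sq_sqrt (by norm_num)
  have h2pos : 0 < √(2 : ℝ) := by positivity
  have hm0 p : 0 ≤ m p := div_nonneg (hq p) (hs0 p)
  have he0 p : 0 < e p := by positivity
  have hetend : Tendsto e atTop (𝓝 0) := by
    simpa [he] using (hLs.abs.const_mul 4).add tendsto_one_div_add_atTop_nhds_zero_nat
  have hsqrt : Tendsto (fun p => √(e p)) atTop (𝓝 0) := by simpa using hetend.sqrt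
  have hk : Tendsto (fun p => √√(e p)) atTop (𝓝 0) := by simpa using hsqrt.sqrt
  have hFlim x : Tendsto (fun p => F p x) atTop (𝓝 (cdf (gaussianReal 0 1) x)) := by
    refine tendsto_weighted_sum_real_le (gaussianReal 0 1) f (by fun_prop)
      integral_sq_sub_one_gaussianReal integral_sq_sub_one_sq_gaussianReal a ?_
      (fun p => √2 * (L p / s p)) (by simpa using hLs.const_mul √2) ?_ x
    · filter_upwards [hspos] with p hp
      simp only [ha, div_pow, mul_pow, h2]
      rw [← Finset.sum_div, ← Finset.mul_sum, ← hs2, div_self (by positivity)]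
    · refine .of_forall fun p j => ?_
      have : 0 ≤ a p j := div_nonneg (mul_nonneg h2pos.le (hw0 p j)) (hs0 p)
      rw [abs_of_nonneg this, ha, ← mul_div_assoc]
      have := hs0 p
      have := hL p j
      dsimp only
      gcongr
  have hmono p : Monotone (F p) := fun x y hxy =>
    measureReal_mono (fun v (hv : _ ≤ x) => hv.trans hxy)
  have hF0 p x : 0 ≤ F p x := measureReal_nonneg
  have hup := (tendsto_shifted_sub hmono hF0 continuous_cdf_gaussianReal
    (tendsto_cdf_atBot _) hFlim hm0 hk z).add hsqrt
  have hlow := (tendsto_shifted_sub hmono hF0 continuous_cdf_gaussianReal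
    (tendsto_cdf_atBot _) hFlim hm0 (k := fun p => -√√(e p)) (by simpa using hk.neg) z).sub hsqrt
  rw [add_zero] at hup
  rw [sub_zero] at hlow
  -- The variance is at most `e m ≤ e (1 + m)²`; the radius `e^{1/4} (1 + m)` therefore leaves
  -- probability `√e`.
  have hcheb : ∀ᶠ p in atTop, (Measure.pi fun _ : Fin p => gaussianReal 0 1).real
      {x | √√(e p) * (1 + m p) ≤ |∑ j, 2 * c p j / s p * x j|} ≤ √(e p) := by
    filter_upwards [hspos] with p hp
    have hmp := hm0 p
    have hep := Real.sqrt_pos.2 (he0 p)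
    have hkp := Real.sqrt_pos.2 hep
    refine (real_le_abs_linear_form_le _ (by positivity)).trans ?_
    rw [div_le_iff₀ (by positivity), mul_pow, Real.sq_sqrt hep.le, ← mul_assoc,
      Real.mul_self_sqrt (he0 p).le]
    calc ∑ j, (2 * c p j / s p) ^ 2 = 4 * (∑ j, c p j ^ 2) / s p ^ 2 := by
          simp_rw [div_pow, mul_pow]
          rw [← Finset.sum_div, ← Finset.mul_sum]
          norm_num
      _ ≤ 4 * (L p * q p) / s p ^ 2 := by
          gcongr
          exact hc p
      _ = 4 * (L p / s p) * m p := by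
          simp only [hm]
          field_simp
      _ ≤ e p * m p := by
          refine mul_le_mul_of_nonneg_right ?_ hmp
          have h1 := le_abs_self (L p / s p)
          have h3 : 0 ≤ 1 / ((p : ℝ) + 1) := by positivity
          simp only [he]
          linarith
      _ ≤ e p * (1 + m p) ^ 2 := by
          refine mul_le_mul_of_nonneg_left ?_ (he0 p).le
          nlinarith
  have hdecomp : ∀ᶠ p in atTop, ∀ x : Fin p → ℝ,
      (∑ j, w p j * x j ^ 2 + 2 * ∑ j, c p j * x j + q p - p) / s p
        = ∑ j, a p j * f (x j) + ∑ j, 2 * c p j / s p * x j + m p := by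
    filter_upwards [hspos] with p hp x
    have h1 : ∑ j, a p j * f (x j) = (∑ j, w p j * x j ^ 2 - p) / s p := by
      rw [← hw1 p, ← Finset.sum_sub_distrib, Finset.sum_div]
      refine Finset.sum_congr rfl fun j _ => ?_
      simp only [ha, hf]
      field_simp
    have h3 : ∑ j, 2 * c p j / s p * x j = 2 * (∑ j, c p j * x j) / s p := by
      rw [Finset.mul_sum, Finset.sum_div]
      exact Finset.sum_congr rfl fun j _ => by ring
    rw [h1, h3]
    simp only [hm]
    ring
  -- Off the Chebyshev event, the linear term moves the threshold `z - m` by less than `√√(e p) * (1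
  -- + m p)` in either direction.
  refine tendsto_of_tendsto_of_tendsto_of_le_of_le' hlow hup ?_ ?_
  · filter_upwards [hcheb, hdecomp] with p h1 h3
    simp only [h3]
    have : F p (z - m p + -√√(e p) * (1 + m p)) ≤ _ :=
      (measureReal_mono (s₂ := {x : Fin p → ℝ |
        ∑ j, a p j * f (x j) + ∑ j, 2 * c p j / s p * x j + m p ≤ z} ∪
        {x | √√(e p) * (1 + m p) ≤ |∑ j, 2 * c p j / s p * x j|}) (fun x hx => by
          simp only [Set.mem_ofPred_eq, Set.mem_union] at hx ⊢
          by_contra! hcon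
          have := le_abs_self (∑ j, 2 * c p j / s p * x j)
          linarith [hcon.1, hcon.2])).trans (measureReal_union_le _ _)
    linarith
  · filter_upwards [hcheb, hdecomp] with p h1 h3
    simp only [h3]
    have := (measureReal_mono (μ := Measure.pi fun _ : Fin p => gaussianReal 0 1)
      (s₁ := {x : Fin p → ℝ |
        ∑ j, a p j * f (x j) + ∑ j, 2 * c p j / s p * x j + m p ≤ z})
      (s₂ := {x | ∑ j, a p j * f (x j) ≤ z - m p + √√(e p) * (1 + m p)} ∪
        {x | √√(e p) * (1 + m p) ≤ |∑ j, 2 * c p j / s p * x j|}) (fun x hx => by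
          simp only [Set.mem_ofPred_eq, Set.mem_union] at hx ⊢
          by_contra! hcon
          have := neg_abs_le (∑ j, 2 * c p j / s p * x j)
          linarith [hcon.1, hcon.2])).trans (measureReal_union_le _ _)
    simp only [hF]
    linarith

/-! ### Reduction of the chart statistic to the eigenvalues of `ρ` -/

theorem inner_toEuclideanCLM_left {ι : Type*} [Fintype ι] [DecidableEq ι] (B : Matrix ι ι ℝ)
    (x t : EuclideanSpace ℝ ι) :
    inner ℝ (toEuclideanCLM (𝕜 := ℝ) B x) t = inner ℝ x (toEuclideanCLM (𝕜 := ℝ) Bᵀ t) := by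
  rw [real_inner_comm, inner_toEuclideanCLM, inner_toEuclideanCLM, mulVec_transpose,
    dotProduct_mulVec, dotProduct_comm]

theorem norm_toEuclideanCLM_sq {ι : Type*} [Fintype ι] [DecidableEq ι] (B : Matrix ι ι ℝ)
    (x : EuclideanSpace ℝ ι) :
    ‖toEuclideanCLM (𝕜 := ℝ) B x‖ ^ 2 = x ⬝ᵥ (Bᵀ * B) *ᵥ x := by
  rw [← real_inner_self_eq_norm_sq, inner_toEuclideanCLM_left, inner_toEuclideanCLM,
    ofLp_toEuclideanCLM, mulVec_mulVec]

/-- The law of a linear image of a standard Gaussian vector only depends on its covariance. -/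
theorem stdGaussian_map_toEuclideanCLM_congr {ι : Type*} [Fintype ι] [DecidableEq ι]
    {B C : Matrix ι ι ℝ} (h : B * Bᵀ = C * Cᵀ) :
    (stdGaussian (EuclideanSpace ℝ ι)).map (toEuclideanCLM (𝕜 := ℝ) B)
      = (stdGaussian (EuclideanSpace ℝ ι)).map (toEuclideanCLM (𝕜 := ℝ) C) := by
  have key (A : Matrix ι ι ℝ) (t : EuclideanSpace ℝ ι) :
      charFun ((stdGaussian (EuclideanSpace ℝ ι)).map (toEuclideanCLM (𝕜 := ℝ) A)) t
        = Complex.exp (-((t ⬝ᵥ (A * Aᵀ) *ᵥ t : ℝ) : ℂ) / 2) := by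
    rw [charFun_apply, integral_map (by fun_prop) (by fun_prop)]
    simp_rw [inner_toEuclideanCLM_left]
    rw [← charFun_apply, charFun_stdGaussian, ← Complex.ofReal_pow, norm_toEuclideanCLM_sq,
      transpose_transpose]
  have hp (A : Matrix ι ι ℝ) : IsProbabilityMeasure
      ((stdGaussian (EuclideanSpace ℝ ι)).map (toEuclideanCLM (𝕜 := ℝ) A)) :=
    Measure.isProbabilityMeasure_map (by fun_prop)
  refine Measure.ext_of_charFun (funext fun t => ?_)
  rw [key, key, h]

open scoped MatrixOrder in
theorem exists_symm_sqrt {ι : Type*} [Fintype ι] [DecidableEq ι] {S : Matrix ι ι ℝ}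
    (hS : S.PosSemidef) : (CFC.sqrt S)ᵀ = CFC.sqrt S ∧ CFC.sqrt S * CFC.sqrt S = S := by
  refine ⟨?_, CFC.sqrt_mul_sqrt_self S hS.nonneg⟩
  simpa using (CFC.sqrt_nonneg S).posSemidef.isHermitian.eq

variable {p : ℕ} {S : Matrix (Fin p) (Fin p) ℝ}

theorem invVarianceForm_eq_norm_sq (hvar : ∀ j, 0 < S j j) (v : EuclideanSpace ℝ (Fin p)) :
    invVarianceForm S v = ‖toEuclideanCLM (𝕜 := ℝ) (invSqrtVarianceMatrix S) v‖ ^ 2 := by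
  have hinv : (varianceMatrix S)⁻¹ = diagonal fun j => (S j j)⁻¹ := by
    refine Matrix.inv_eq_right_inv ?_
    simp [varianceMatrix, diagonal_mul_diagonal, fun j => (hvar j).ne']
  have hd : (invSqrtVarianceMatrix S)ᵀ * invSqrtVarianceMatrix S = diagonal fun j => (S j j)⁻¹ := by
    simp only [invSqrtVarianceMatrix, diagonal_transpose, diagonal_mul_diagonal, ← mul_inv]
    simp_rw [Real.mul_self_sqrt (hvar _).le]
  rw [norm_toEuclideanCLM_sq, hd, invVarianceForm, hinv]

theorem measurable_chartStatistic (hvar : ∀ j, 0 < S j j) (μ : EuclideanSpace ℝ (Fin p)) :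
    Measurable fun x : EuclideanSpace ℝ (Fin p) => chartStatistic S μ x := by
  simp only [chartStatistic, modifiedMahalanobisSq, invVarianceForm_eq_norm_sq hvar]
  fun_prop

theorem correlationMatrix_apply_self (hvar : ∀ j, 0 < S j j) (j : Fin p) :
    correlationMatrix S j j = 1 := by
  have := Real.mul_self_sqrt (hvar j).le
  have h0 := (Real.sqrt_pos.2 (hvar j)).ne'
  simp only [correlationMatrix, invSqrtVarianceMatrix, mul_diagonal, diagonal_mul]
  field_simp
  nlinarith

theorem correlationMatrix_posSemidef (hS : S.PosSemidef) : (correlationMatrix S).PosSemidef := by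
  have h := hS.mul_mul_conjTranspose_same (invSqrtVarianceMatrix S)
  have h2 : (invSqrtVarianceMatrix S)ᴴ = invSqrtVarianceMatrix S := by
    simp [invSqrtVarianceMatrix]
  rwa [h2] at h

theorem trace_correlationMatrix (hvar : ∀ j, 0 < S j j) : (correlationMatrix S).trace = p := by
  simp [trace, correlationMatrix_apply_self hvar]

theorem eigenvalues_le_maxEigenvalue (hS : S.PosSemidef) (j : Fin p) :
    (correlationMatrix_isHermitian hS).eigenvalues j ≤ maxEigenvalue hS :=
  le_ciSup (Set.finite_range _).bddAbove j

/-- The spectral theorem for real symmetric matrices in terms of an orthogonal matrix. -/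
theorem exists_orthogonal_diagonalization {A : Matrix (Fin p) (Fin p) ℝ} (hA : A.IsHermitian) :
    ∃ U : Matrix (Fin p) (Fin p) ℝ, U * Uᵀ = 1 ∧ Uᵀ * U = 1 ∧
      A = U * diagonal hA.eigenvalues * Uᵀ := by
  refine ⟨hA.eigenvectorUnitary, ?_, ?_, ?_⟩
  · simpa [star_eq_conjTranspose] using Unitary.coe_mul_star_self hA.eigenvectorUnitary
  · simpa [star_eq_conjTranspose] using Unitary.coe_star_mul_self hA.eigenvectorUnitary
  · conv_lhs => rw [hA.spectral_theorem, Unitary.conjStarAlgAut_apply]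
    simp [star_eq_conjTranspose]

theorem trace_sq_eq_sum_eigenvalues_sq {A : Matrix (Fin p) (Fin p) ℝ} (hA : A.IsHermitian) :
    (A ^ 2).trace = ∑ j, hA.eigenvalues j ^ 2 := by
  obtain ⟨U, -, hU, h⟩ := exists_orthogonal_diagonalization hA
  have : A ^ 2 = U * (diagonal hA.eigenvalues * (Uᵀ * U) * diagonal hA.eigenvalues * Uᵀ) := by
    conv_lhs => rw [h]
    noncomm_ring
  rw [this, trace_mul_comm, hU, Matrix.mul_one, Matrix.mul_assoc _ Uᵀ U, hU, Matrix.mul_one,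
    diagonal_mul_diagonal, trace_diagonal]
  simp [sq]

open scoped MatrixOrder in
/-- The chart statistic of a Gaussian vector is distributed as a standardized weighted sum of
noncentral chi-square variables, the weights being the eigenvalues of the correlation matrix. -/
theorem exists_chartStatistic_law (hS : S.PosSemidef) (hvar : ∀ j, 0 < S j j)
    (μ μ₁ : EuclideanSpace ℝ (Fin p)) :
    ∃ c : Fin p → ℝ, ∑ j, c j ^ 2 ≤ maxEigenvalue hS * invVarianceForm S (μ₁ - μ) ∧
      ∀ z, (multivariateGaussian μ₁ S).real {x | chartStatistic S μ x ≤ z}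
        = (Measure.pi fun _ : Fin p => gaussianReal 0 1).real
          {x | (∑ j, (correlationMatrix_isHermitian hS).eigenvalues j * x j ^ 2
            + 2 * ∑ j, c j * x j + invVarianceForm S (μ₁ - μ) - p)
              / √(2 * (correlationMatrix S ^ 2).trace) ≤ z} := by
  set hρ := correlationMatrix_isHermitian hS
  have hl0 : ∀ j, 0 ≤ hρ.eigenvalues j := (correlationMatrix_posSemidef hS).eigenvalues_nonneg
  obtain ⟨hsym, hsq⟩ := exists_symm_sqrt hS
  obtain ⟨U, hU1, hU2, hUA⟩ := exists_orthogonal_diagonalization hρ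
  set R := CFC.sqrt S with hR
  set A := invSqrtVarianceMatrix S with hA
  set d : Matrix (Fin p) (Fin p) ℝ := diagonal fun j => √(hρ.eigenvalues j) with hd
  set C := U * d with hC
  set η := toEuclideanCLM (𝕜 := ℝ) A (μ₁ - μ) with hη
  have hdd : d * d = diagonal hρ.eigenvalues := by
    simp only [hd, diagonal_mul_diagonal]
    simp_rw [Real.mul_self_sqrt (hl0 _)]
  have hdT : dᵀ = d := by simp [hd]
  have hAT : Aᵀ = A := by simp [hA, invSqrtVarianceMatrix]
  -- Both `D^{-1/2} S^{1/2}` and `U Λ^{1/2}` factor `ρ`, so they send the standard Gaussian to the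
  -- same law; the second makes the quadratic form diagonal.
  have hcov : (A * R) * (A * R)ᵀ = C * Cᵀ := by
    rw [transpose_mul, hsym, hAT, hC, transpose_mul, hdT]
    calc A * R * (R * A) = A * (R * R) * A := by noncomm_ring
      _ = correlationMatrix S := by rw [hsq, correlationMatrix]
      _ = U * (d * d) * Uᵀ := by rw [hdd]; exact hUA
      _ = U * d * (d * Uᵀ) := by noncomm_ring
  have hCC : Cᵀ * C = diagonal hρ.eigenvalues := by
    rw [hC, transpose_mul, hdT, Matrix.mul_assoc, ← Matrix.mul_assoc Uᵀ, hU2, Matrix.one_mul, hdd]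
  have hq : invVarianceForm S (μ₁ - μ) = ‖η‖ ^ 2 := invVarianceForm_eq_norm_sq hvar _
  refine ⟨toEuclideanCLM (𝕜 := ℝ) Cᵀ η, ?_, fun z => ?_⟩
  -- In the eigenbasis `c_j = √λ_j h_j` with `h = Uᵀ η`, and `U` preserves `‖η‖² = q`.
  · set h := toEuclideanCLM (𝕜 := ℝ) Uᵀ η with hh
    have hn : ‖η‖ ^ 2 = ∑ j, h j ^ 2 := by
      have h1 := norm_toEuclideanCLM_sq Uᵀ η
      rw [transpose_transpose, hU1, one_mulVec] at h1
      rw [← EuclideanSpace.real_norm_sq_eq, hh, h1, EuclideanSpace.real_norm_sq_eq]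
      simp [dotProduct, sq]
    have hj (j : Fin p) : toEuclideanCLM (𝕜 := ℝ) Cᵀ η j = √(hρ.eigenvalues j) * h j := by
      rw [hC, transpose_mul, hdT, ofLp_toEuclideanCLM, ← mulVec_mulVec, hd, mulVec_diagonal]
      rfl
    rw [hq, hn, Finset.mul_sum]
    refine Finset.sum_le_sum fun j _ => ?_
    rw [hj, mul_pow, Real.sq_sqrt (hl0 j)]
    exact mul_le_mul_of_nonneg_right (eigenvalues_le_maxEigenvalue hS j) (sq_nonneg _)
  · set s := √(2 * (correlationMatrix S ^ 2).trace)
    set K : Set (EuclideanSpace ℝ (Fin p)) := {y | (‖η + y‖ ^ 2 - p) / s ≤ z} with hK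
    have hKm : MeasurableSet K := measurableSet_le (by fun_prop) (by fun_prop)
    have h1 : (multivariateGaussian μ₁ S).real {x | chartStatistic S μ x ≤ z}
        = ((stdGaussian (EuclideanSpace ℝ (Fin p))).map
          (toEuclideanCLM (𝕜 := ℝ) (A * R))).real K := by
      rw [multivariateGaussian, map_measureReal_apply (by fun_prop)
        (measurableSet_le (measurable_chartStatistic hvar μ) measurable_const), map_measureReal_apply (by fun_prop) hKm]
      congr 1
      ext x
      simp only [Set.mem_preimage, Set.mem_ofPred_eq, hK, chartStatistic, modifiedMahalanobisSq,
        invVarianceForm_eq_norm_sq hvar, hη, map_mul, mul_apply_eq_comp, ← map_add]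
      rw [show μ₁ + toEuclideanCLM (𝕜 := ℝ) (CFC.sqrt S) x - μ
        = μ₁ - μ + toEuclideanCLM (𝕜 := ℝ) R x by rw [hR]; abel]
    rw [h1, stdGaussian_map_toEuclideanCLM_congr hcov, ← map_pi_eq_stdGaussian,
      map_measureReal_apply (by fun_prop) hKm, map_measureReal_apply (by fun_prop)
        ((toEuclideanCLM (𝕜 := ℝ) C).continuous.measurable hKm)]
    congr 1
    ext x
    have hx : ‖η + toEuclideanCLM (𝕜 := ℝ) C (WithLp.toLp 2 x)‖ ^ 2
        = ∑ j, hρ.eigenvalues j * x j ^ 2 + 2 * ∑ j, toEuclideanCLM (𝕜 := ℝ) Cᵀ η j * x j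
          + ‖η‖ ^ 2 := by
      rw [norm_add_sq_real, norm_toEuclideanCLM_sq C, hCC, real_inner_comm,
        inner_toEuclideanCLM_left]
      simp only [PiLp.inner_apply, dotProduct, mulVec_diagonal]
      have e1 : ∑ j, x j * (hρ.eigenvalues j * x j) = ∑ j, hρ.eigenvalues j * x j ^ 2 :=
        Finset.sum_congr rfl fun j _ => by ring
      rw [e1]
      simp
      ring
    simp only [Set.mem_preimage, Set.mem_ofPred_eq, hK, hx, hq]

end MeanChart

/-! ### Asymptotics of the spectrum and conclusion -/

/-- The case `i = 2` of the trace assumption makes `√(2 tr ρ²)` of exact order `√p`, whereas the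
largest eigenvalue is `o(√p)`. -/
theorem MeanChart.tendsto_maxEigenvalue_div_sqrt_trace
    {S : ∀ p : ℕ, Matrix (Fin p) (Fin p) ℝ} (hS : ∀ p, (S p).PosSemidef)
    (hA1 : MeanChart.TraceAssumption S) (hA2 : MeanChart.EigenvalueAssumption S hS) :
    (∀ᶠ p in atTop, 0 < √(2 * (MeanChart.correlationMatrix (S p) ^ 2).trace)) ∧
      Tendsto (fun p => MeanChart.maxEigenvalue (hS p) /
        √(2 * (MeanChart.correlationMatrix (S p) ^ 2).trace)) atTop (𝓝 0) := by
  obtain ⟨l, hl, hlim⟩ := hA1 2 (by simp)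
  have hpos : ∀ᶠ p in atTop, 0 < √(2 * (MeanChart.correlationMatrix (S p) ^ 2).trace) := by
    filter_upwards [hlim.eventually_const_lt hl] with p hp
    have := pos_of_mul_pos_right hp (by positivity)
    positivity
  refine ⟨hpos, ?_⟩
  have hs := (hlim.const_mul 2).sqrt
  have hdiv := hA2.div hs (Real.sqrt_pos.2 (by positivity)).ne'
  rw [zero_div] at hdiv
  refine hdiv.congr' ?_
  filter_upwards [eventually_gt_atTop 0] with p hp
  have hp' : (0 : ℝ) < p := by exact_mod_cast hp
  have h1 : √(2 * ((p : ℝ)⁻¹ * (MeanChart.correlationMatrix (S p) ^ 2).trace))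
      = √(2 * (MeanChart.correlationMatrix (S p) ^ 2).trace) * (p : ℝ) ^ (-(1 / 2 : ℝ)) := by
    rw [Real.rpow_neg hp'.le, ← Real.sqrt_eq_rpow, ← Real.sqrt_inv,
      ← Real.sqrt_mul' _ (by positivity)]
    ring_nf
  rw [Pi.div_apply, h1, mul_div_mul_right _ _ (Real.rpow_pos_of_pos hp' _).ne']

theorem theorem2
    (S : ∀ p : ℕ, Matrix (Fin p) (Fin p) ℝ)
    (hS : ∀ p, (S p).PosSemidef)
    (hvar : ∀ p, ∀ j : Fin p, 0 < S p j j)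
    (hA1 : MeanChart.TraceAssumption S)
    (hA2 : MeanChart.EigenvalueAssumption S hS)
    (μ μ₁ : ∀ p : ℕ, EuclideanSpace ℝ (Fin p))
    (ε : ℝ) (hε : 0 < ε)
    (hδ : MeanChart.ShiftOrder (fun p => μ₁ p - μ p) ε)
    (α : ℝ) (hα0 : 0 < α) (hα1 : α < 1)
    {Ω : ℕ → Type*} [∀ p, MeasurableSpace (Ω p)]
    (P : ∀ p, Measure (Ω p)) [∀ p, IsProbabilityMeasure (P p)]
    (X : ∀ p, Ω p → EuclideanSpace ℝ (Fin p))
    (hX : ∀ p, HasLaw (X p) (multivariateGaussian (μ₁ p) (S p)) (P p)) :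
    Tendsto
      (fun p : ℕ =>
        (P p).real {ω | MeanChart.chartStatistic (S p) (μ p) (X p ω) ≤
            MeanChart.upperPercentile α} -
          MeanChart.stdNormalCDF
            (MeanChart.upperPercentile α -
              MeanChart.invVarianceForm (S p) (μ₁ p - μ p) /
                √(2 * (MeanChart.correlationMatrix (S p) ^ 2).trace)))
      atTop (𝓝 0) := by
  obtain ⟨hspos, hLs⟩ := MeanChart.tendsto_maxEigenvalue_div_sqrt_trace hS hA1 hA2
  choose c hc hlaw using fun p =>
    MeanChart.exists_chartStatistic_law (hS p) (hvar p) (μ p) (μ₁ p)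
  have hmeas p : MeasurableSet
      {x | MeanChart.chartStatistic (S p) (μ p) x ≤ MeanChart.upperPercentile α} :=
    measurableSet_le (MeanChart.measurable_chartStatistic (hvar p) (μ p)) measurable_const
  have hP p := (hX p).measureReal_eq (hmeas p)
  have hsum p : (MeanChart.correlationMatrix (S p)).trace
      = ∑ j, (MeanChart.correlationMatrix_isHermitian (hS p)).eigenvalues j := by
    simpa using (MeanChart.correlationMatrix_isHermitian (hS p)).trace_eq_sum_eigenvalues
  have hsq p := MeanChart.trace_sq_eq_sum_eigenvalues_sq
    (MeanChart.correlationMatrix_isHermitian (hS p))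
  simp_rw [MeanChart.stdNormalCDF, hP, hlaw]
  -- The weights are the eigenvalues of `ρ`; they sum to `p` because `ρ` has unit diagonal.
  refine MeanChart.tendsto_noncentral_quadratic_form_sub_cdf _
    (fun p => (MeanChart.correlationMatrix_posSemidef (hS p)).eigenvalues_nonneg)
    (fun p => (hsum p).symm.trans (MeanChart.trace_correlationMatrix (hvar p)))
    _ (fun p => Real.sqrt_nonneg _) hspos (fun p => ?_) _
    (fun p => MeanChart.eigenvalues_le_maxEigenvalue (hS p)) hLs _ (fun p => ?_) c hc _
  · rw [hsq, Real.sq_sqrt (by positivity)]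
  · rw [MeanChart.invVarianceForm_eq_norm_sq (hvar p)]
    positivity
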